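/- Let $\alpha=2k+1\ge 5$ be an odd integer, put $\varepsilon=e^{\pi i/(2\alpha)}$, and for real $\mu$ let $A_\alpha(\mu)$ be the complex $2\alpha\times 2\alpha$ matrix whose columns are indexed by $j=0,1,\dots,2\alpha-1$ and whose $j$-th column is $$\left(1,\ z_j,\ z_j^2,\ \dots,\ z_j^{\alpha-1},\ e^{\mu z_j},\ e^{\mu z_j}z_j,\ e^{\mu z_j}z_j^2,\ \dots,\ e^{\mu z_j}z_j^{\alpha-1}\right)^{\top},\qquad z_j=\varepsilon^{2j+1}.$$ Put $$c_\ell=\cos\frac{\ell\pi}{2\alpha},\qquad s_\ell=\sin\frac{\ell\pi}{2\alpha}\qquad(\ell=1,3,\dots,2k-1),\qquad \sigma=2\sum_{j=1}^{k-2}c_{2j-1},$$ where the empty sum for $k=2$ is $0$, and $$\gamma_1=\sigma+2c_{2k-3}+2c_{2k-1},\qquad \gamma_2=\sigma+2c_{2k-3}+c_{2k-1},\qquad \gamma_3=\sigma+c_{2k-3}+2c_{2k-1}.$$ Then there are nonzero complex constants $K_1,K_2$ (depending only on $\alpha$) such that $$-\frac{K_2}{K_1}=\frac{2}{\sin^2\frac{\pi}{2\alpha}}$$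 and $$\det A_\alpha(\mu)=K_1e^{\gamma_1\mu}\sin\mu+K_2e^{\gamma_2\mu}\sin(s_{2k-1}\mu)+O\!\left(e^{\gamma_3\mu}\right)\qquad\text{as }\mu\to+\infty .$$ -/

import Mathlib

open Filter Asymptotics

noncomputable section

/-- The primitive `4α`-th root of unity `ε = exp (π i / (2α))`. The numbers `ε ^ (2 j + 1)`,
`0 ≤ j < 2α`, are the solutions of `z ^ (2α) = -1`. -/
def rootEps (α : ℕ) : ℂ :=
  Complex.exp ((Real.pi : ℂ) * Complex.I / (2 * (α : ℂ)))

/-- The `2α × 2α` matrix `A_α(μ)` of the boundary conditions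
`u^{(m)}(0) = 0`, `u^{(m)}(1) = 0` (`0 ≤ m < α`) applied to the functions
`x ↦ exp (μ ε^{2j+1} x)`, `0 ≤ j < 2α`, with the common factor `μ ^ m` of each row removed.
The first `α` rows (`i = m`) have the entries `ε^{(2j+1) m}`; the last `α` rows
(`i = α + m`) have the entries `exp (μ ε^{2j+1}) ε^{(2j+1) m}`. -/
def boundaryMatrix (α : ℕ) (μ : ℝ) : Matrix (Fin (2 * α)) (Fin (2 * α)) ℂ :=
  Matrix.of fun i j =>
    if (i : ℕ) < α then
      (rootEps α ^ (2 * (j : ℕ) + 1)) ^ (i : ℕ)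
    else
      Complex.exp ((μ : ℂ) * rootEps α ^ (2 * (j : ℕ) + 1)) *
        (rootEps α ^ (2 * (j : ℕ) + 1)) ^ ((i : ℕ) - α)

/-- `c_ℓ = cos (ℓ π / (2α))`. -/
def cosCoeff (α ℓ : ℕ) : ℝ := Real.cos (ℓ * Real.pi / (2 * α))

/-- `s_ℓ = sin (ℓ π / (2α))`. -/
def sinCoeff (α ℓ : ℕ) : ℝ := Real.sin (ℓ * Real.pi / (2 * α))

/-- `σ = 2 ∑_{j=1}^{k-2} c_{2j-1}` (for `k ≥ 2`; the sum is empty for `k = 2`). -/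
def sigmaSum (α k : ℕ) : ℝ := 2 * ∑ j ∈ Finset.Icc 1 (k - 2), cosCoeff α (2 * j - 1)

/-- `γ₁ = σ + 2 c_{2k-3} + 2 c_{2k-1}` (for `k ≥ 2`). -/
def gammaOne (α k : ℕ) : ℝ :=
  sigmaSum α k + 2 * cosCoeff α (2 * k - 3) + 2 * cosCoeff α (2 * k - 1)

/-- `γ₂ = σ + 2 c_{2k-3} + c_{2k-1}` (for `k ≥ 2`). -/
def gammaTwo (α k : ℕ) : ℝ :=
  sigmaSum α k + 2 * cosCoeff α (2 * k - 3) + cosCoeff α (2 * k - 1)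

/-- `γ₃ = σ + c_{2k-3} + 2 c_{2k-1}` (for `k ≥ 2`). -/
def gammaThree (α k : ℕ) : ℝ :=
  sigmaSum α k + cosCoeff α (2 * k - 3) + 2 * cosCoeff α (2 * k - 1)

end

/-! Laplace expansion along the upper and lower halves turns the determinant into an exponential sum
over the `α`-element subsets `T` of the roots of `z ^ (2α) = -1`: the exponent is `μ ∑ T`, and the
coefficient is the Vandermonde determinant `V` over the product of all `b - a` with `b ∈ T`, `a ∉ T`
(`det_stackedPowers_exp`).

As `α = 2k + 1` is odd, the roots are `P ∪ -P ∪ {i, -i}`, where `P` is the set of `2k` roots in the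
right half-plane. The real part of `∑ T` is largest for `P ∪ {i}` and `P ∪ {-i}`. The smallest loss
is `c = c_{2k-1}`, caused by the conjugate pair `p`, `q` of `P` nearest the imaginary axis: either
`t ∈ {p, q}` is dropped and both `±i` are taken, or `-t` is added to `P`. Every other `T` loses at
least `c' = c_{2k-3}`, because two losses cost at least `2c ≥ c'` (`re_sum_le_of_not_dominant`).

Let `D` be the product of `b + a` over `P × P` times `(∏ (b + i)) ^ 2`, and `h = π / (2α)`. The
difference products of the two leading sets are `±2iD`, which gives `K₁ = V / D`. Those of the other
four are `±iD t c` with `t = tan h`, by a telescoping product of tangents (`prod_erase_last_sub`),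
which gives `K₂ = -4 K₁ / (t c)`. Since `c = sin 2h`, `t c = 2 sin² h`, and this is the stated
ratio. -/

open scoped Pointwise

/-! ### Laplace expansion of the determinant into an exponential sum -/

/-- The matrix whose `j`-th column consists of the powers `z j ^ m`, `m < n`, followed by the same
powers multiplied by `w j`. -/
def stackedPowers (n : ℕ) (z w : Fin (2 * n) → ℂ) : Matrix (Fin (2 * n)) (Fin (2 * n)) ℂ :=
  Matrix.of fun i j => if (i : ℕ) < n then z j ^ (i : ℕ) else w j * z j ^ ((i : ℕ) - n)

/-- The powers of `z j` in the lower half of the `j`-th column for `j ∈ S`, in the upper half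
otherwise, and zeros elsewhere. -/
def splitPowers (n : ℕ) (z : Fin (2 * n) → ℂ) (S : Finset (Fin (2 * n))) :
    Matrix (Fin (2 * n)) (Fin (2 * n)) ℂ :=
  Matrix.of fun i j =>
    if (i : ℕ) < n then (if j ∈ S then 0 else z j ^ (i : ℕ))
    else (if j ∈ S then z j ^ ((i : ℕ) - n) else 0)

theorem det_stackedPowers_eq_sum (n : ℕ) (z w : Fin (2 * n) → ℂ) :
    (stackedPowers n z w).det =
      ∑ S : Finset (Fin (2 * n)), (∏ j ∈ S, w j) * (splitPowers n z S).det := by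
  classical
  let lower : Fin (2 * n) → Fin (2 * n) → ℂ := fun j i =>
    if (i : ℕ) < n then 0 else w j * z j ^ ((i : ℕ) - n)
  let upper : Fin (2 * n) → Fin (2 * n) → ℂ := fun j i =>
    if (i : ℕ) < n then z j ^ (i : ℕ) else 0
  have hsum : (stackedPowers n z w).transpose = lower + upper := by
    ext j i
    by_cases hi : (i : ℕ) < n <;> simp [stackedPowers, lower, upper, hi]
  have hdet : (stackedPowers n z w).det =
      (Matrix.detRowAlternating (R := ℂ)).toMultilinearMap (lower + upper) := by
    rw [← Matrix.det_transpose, hsum]; rfl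
  rw [hdet, MultilinearMap.map_add_univ]
  refine Finset.sum_congr rfl fun S _ => ?_
  have hcol := Matrix.det_mul_row (fun j => if j ∈ S then w j else 1) (splitPowers n z S)
  rw [Finset.prod_ite_mem, Finset.univ_inter] at hcol
  rw [← hcol, ← Matrix.det_transpose]
  change Matrix.det (S.piecewise lower upper) = _
  congr 1
  ext j i
  by_cases hi : (i : ℕ) < n <;> by_cases hj : j ∈ S <;>
    simp [splitPowers, Finset.piecewise, lower, upper, hi, hj]

theorem card_filter_val_lt (n : ℕ) :
    (Finset.univ.filter fun i : Fin (2 * n) => (i : ℕ) < n).card = n := by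
  rw [Fin.card_filter_val_lt]; omega

/-- A nonzero term of the Leibniz formula needs a permutation carrying `Sᶜ` exactly onto the first
`n` rows. -/
theorem det_splitPowers_eq_zero (n : ℕ) (z : Fin (2 * n) → ℂ) (S : Finset (Fin (2 * n)))
    (hS : S.card ≠ n) : (splitPowers n z S).det = 0 := by
  classical
  rw [Matrix.det_apply]
  refine Finset.sum_eq_zero fun σ _ => ?_
  suffices h : ∃ j, splitPowers n z S (σ j) j = 0 by
    obtain ⟨j, hj⟩ := h
    have hprod : ∏ i, splitPowers n z S (σ i) i = 0 :=
      Finset.prod_eq_zero (Finset.mem_univ j) hj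
    exact (congrArg (Equiv.Perm.sign σ • ·) hprod).trans (smul_zero _)
  by_contra! h
  have hmem : ∀ j, j ∈ Sᶜ ↔ ((σ j : Fin (2 * n)) : ℕ) < n := by
    intro j
    have := h j
    rw [Finset.mem_compl]
    by_cases hi : ((σ j : Fin (2 * n)) : ℕ) < n <;> by_cases hj : j ∈ S <;>
      simp_all [splitPowers]
  have hmap : Sᶜ.map σ.toEmbedding =
      Finset.univ.filter fun i : Fin (2 * n) => (i : ℕ) < n := by
    ext i
    rw [Finset.mem_map_equiv, hmem]
    simp
  have hcard := congrArg Finset.card hmap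
  rw [Finset.card_map, card_filter_val_lt, Finset.card_compl, Fintype.card_fin] at hcard
  have := Finset.card_le_univ S
  rw [Fintype.card_fin] at this
  omega

/-- The Vandermonde determinant in terms of the powers `1, …, X ^ (n - 1)` and their multiples by a
monic polynomial of degree `n`. -/
theorem det_eval_powers_mul (n : ℕ) (z : Fin (2 * n) → ℂ) (q : Polynomial ℂ) (hq : q.Monic)
    (hdeg : q.natDegree = n) :
    (Matrix.of fun i j : Fin (2 * n) =>
      if (i : ℕ) < n then z j ^ (i : ℕ) else q.eval (z j) * z j ^ ((i : ℕ) - n)).det =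
      (Matrix.vandermonde z).det := by
  let p : Fin (2 * n) → Polynomial ℂ := fun i =>
    if (i : ℕ) < n then Polynomial.X ^ (i : ℕ) else q * Polynomial.X ^ ((i : ℕ) - n)
  rw [← Matrix.det_transpose]
  rw [Matrix.det_eval_matrixOfPolynomials_eq_det_vandermonde z p]
  · congr 1
    ext j i
    by_cases hi : (i : ℕ) < n <;> simp [p, hi]
  · intro i
    by_cases hi : (i : ℕ) < n
    · simp [p, hi]
    · simp only [p, hi, if_false]
      rw [hq.natDegree_mul (Polynomial.monic_X_pow _), hdeg, Polynomial.natDegree_X_pow]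
      omega
  · intro i
    by_cases hi : (i : ℕ) < n
    · simp [p, hi, Polynomial.monic_X_pow]
    · simp only [p, hi, if_false]
      exact hq.mul (Polynomial.monic_X_pow _)

theorem det_submatrix_equiv_equiv {m l : Type*} [Fintype m] [DecidableEq m] [Fintype l]
    [DecidableEq l] (r e : l ≃ m) (M : Matrix m m ℂ) :
    (M.submatrix r e).det = (Equiv.Perm.sign (e.trans r.symm) : ℤ) * M.det := by
  rw [← Matrix.det_submatrix_equiv_self r M, ← Matrix.det_permute']
  congr 1
  ext i j
  simp

/-- Take `q = ∏ (X - z a)` over `a ∉ S` in `det_eval_powers_mul`. As `q` vanishes on the columns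
outside `S`, sorting the columns makes that matrix block triangular, with the diagonal blocks of
`splitPowers` up to the factors `q (z b)`. Both matrices are sorted by the same `r` and `e`, so the
sign cancels and need not be computed. -/
theorem det_splitPowers_mul_prod (n : ℕ) (z : Fin (2 * n) → ℂ) (S : Finset (Fin (2 * n)))
    (hS : S.card = n) :
    (splitPowers n z S).det * ∏ b ∈ S, ∏ a ∈ Sᶜ, (z b - z a) = (Matrix.vandermonde z).det := by
  classical
  have hSc : Sᶜ.card = n := by
    rw [Finset.card_compl, Fintype.card_fin, hS]; omega
  let q : Polynomial ℂ := ∏ a ∈ Sᶜ, (Polynomial.X - Polynomial.C (z a))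
  have hq : q.Monic := Polynomial.monic_prod_of_monic _ _ fun a _ => Polynomial.monic_X_sub_C _
  have hdeg : q.natDegree = n := by
    rw [Polynomial.natDegree_prod_of_monic _ _ fun a _ => Polynomial.monic_X_sub_C _]
    simp [hSc]
  have heval : ∀ x, q.eval x = ∏ a ∈ Sᶜ, (x - z a) := fun x => by
    simp [q, Polynomial.eval_prod]
  rw [← det_eval_powers_mul n z q hq hdeg]
  let r : Fin n ⊕ Fin n ≃ Fin (2 * n) := finSumFinEquiv.trans (finCongr (by omega))
  let e : Fin n ⊕ Fin n ≃ Fin (2 * n) := by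
    refine (Equiv.sumCongr (Sᶜ.equivFinOfCardEq hSc).symm (S.equivFinOfCardEq hS).symm).trans ?_
    refine (Equiv.sumComm _ _).trans ?_
    exact (Equiv.sumCongr (Equiv.refl _) (Equiv.subtypeEquivRight (by simp))).trans
      (Equiv.sumCompl (· ∈ S))
  have hel : ∀ j, e (Sum.inl j) ∉ S := fun j => by
    simpa [e] using Finset.mem_compl.1 ((Sᶜ.equivFinOfCardEq hSc).symm j).2
  have her : ∀ j, e (Sum.inr j) ∈ S := fun j => by simp [e]
  have herprod : ∏ b ∈ S, q.eval (z b) = ∏ j, q.eval (z (e (Sum.inr j))) := by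
    rw [← Finset.prod_coe_sort, ← Equiv.prod_comp (S.equivFinOfCardEq hS).symm]
    exact Finset.prod_congr rfl fun j _ => by simp [e]
  have hrl : ∀ i : Fin n, ((r (Sum.inl i) : Fin (2 * n)) : ℕ) = i := fun i => by simp [r]
  have hrr : ∀ i : Fin n, ((r (Sum.inr i) : Fin (2 * n)) : ℕ) = n + i := fun i => by
    simp [r, add_comm]
  let A : Matrix (Fin n) (Fin n) ℂ := Matrix.of fun i j => z (e (Sum.inl j)) ^ (i : ℕ)
  let B : Matrix (Fin n) (Fin n) ℂ := Matrix.of fun i j => z (e (Sum.inr j)) ^ (i : ℕ)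
  have h1 : (splitPowers n z S).submatrix r e = Matrix.fromBlocks A 0 0 B := by
    ext (i | i) (j | j) <;> simp [splitPowers, A, B, hrl, hrr, hel, her]
  have h2 : (Matrix.of fun i j : Fin (2 * n) =>
      if (i : ℕ) < n then z j ^ (i : ℕ) else q.eval (z j) * z j ^ ((i : ℕ) - n)).submatrix r e =
      Matrix.fromBlocks A B 0 (Matrix.of fun i j => q.eval (z (e (Sum.inr j))) * B i j) := by
    ext (i | i) (j | j)
    · simp [A, hrl]
    · simp [B, hrl]
    · simp only [Matrix.submatrix_apply, Matrix.of_apply, hrr, Matrix.fromBlocks_apply₂₁,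
        Matrix.zero_apply]
      rw [if_neg (by omega), heval,
        Finset.prod_eq_zero (Finset.mem_compl.2 (hel j)) (sub_self _), zero_mul]
    · simp [B, hrr]
  have d1 := congrArg Matrix.det h1
  have d2 := congrArg Matrix.det h2
  rw [det_submatrix_equiv_equiv, Matrix.det_fromBlocks_zero₂₁] at d1 d2
  rw [Matrix.det_mul_row, ← herprod] at d2
  simp only [heval] at d2 ⊢
  have hs : ((Equiv.Perm.sign (e.trans r.symm) : ℤ) : ℂ) ≠ 0 := by
    exact_mod_cast (Units.ne_zero (Equiv.Perm.sign (e.trans r.symm)))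
  apply mul_left_cancel₀ hs
  rw [d2, ← mul_assoc, d1]
  ring

/-- The product of the differences `b - a` with `b ∈ T` and `a ∈ Z \ T`. -/
noncomputable def crossDiff (Z T : Finset ℂ) : ℂ := ∏ b ∈ T, ∏ a ∈ Z \ T, (b - a)

theorem crossDiff_ne_zero (Z T : Finset ℂ) : crossDiff Z T ≠ 0 := by
  refine Finset.prod_ne_zero_iff.2 fun b hb => Finset.prod_ne_zero_iff.2 fun a ha => ?_
  rw [Finset.mem_sdiff] at ha
  exact sub_ne_zero.2 fun h => ha.2 (h ▸ hb)

theorem det_stackedPowers_exp (n : ℕ) (z : Fin (2 * n) ↪ ℂ) (μ : ℝ) :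
    (stackedPowers n z fun j => Complex.exp (μ * z j)).det =
      ∑ T ∈ (Finset.univ.map z).powersetCard n,
        (Matrix.vandermonde z).det / crossDiff (Finset.univ.map z) T *
          Complex.exp (μ * ∑ b ∈ T, b) := by
  classical
  rw [det_stackedPowers_eq_sum, Finset.powersetCard_map, Finset.sum_map,
    ← Finset.sum_subset (Finset.subset_univ (Finset.univ.powersetCard n))]
  · refine Finset.sum_congr rfl fun S hS => ?_
    have hcard := (Finset.mem_powersetCard.1 hS).2
    have hmap : (Finset.mapEmbedding z).toEmbedding S = S.map z := rfl
    have hcross : crossDiff (Finset.univ.map z) (S.map z) =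
        ∏ b ∈ S, ∏ a ∈ Sᶜ, (z b - z a) := by
      rw [crossDiff, ← Finset.map_sdiff, Finset.prod_map]
      simp only [Finset.prod_map, Finset.compl_eq_univ_sdiff]
    have hne := crossDiff_ne_zero (Finset.univ.map z) (S.map z)
    rw [hmap, Finset.sum_map, Finset.mul_sum, Complex.exp_sum, mul_comm]
    congr 1
    rw [eq_div_iff hne, hcross, det_splitPowers_mul_prod n z S hcard]
  · intro S _ hS
    rw [det_splitPowers_eq_zero n z S, mul_zero]
    simpa [Finset.mem_powersetCard] using hS

/-! ### Difference products in a set symmetric about the origin -/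

/-- The finite set `P ∪ -P ∪ {i, -i}`. -/
noncomputable def symmSet (P : Finset ℂ) : Finset ℂ := P ∪ -P ∪ {Complex.I, -Complex.I}

theorem mem_symmSet {P : Finset ℂ} {x : ℂ} :
    x ∈ symmSet P ↔ x ∈ P ∨ -x ∈ P ∨ x = Complex.I ∨ x = -Complex.I := by
  simp only [symmSet, Finset.mem_union, Finset.mem_neg', Finset.mem_insert,
    Finset.mem_singleton, or_assoc]

/-- The product of all sums `b + a` with `b ∈ T` and `a ∈ T'`. -/
noncomputable def crossSum (T T' : Finset ℂ) : ℂ := ∏ b ∈ T, ∏ a ∈ T', (b + a)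

theorem crossSum_comm (T T' : Finset ℂ) : crossSum T T' = crossSum T' T := by
  rw [crossSum, Finset.prod_comm]
  simp only [crossSum, add_comm]

theorem crossDiff_eq_crossSum {Z T T' : Finset ℂ} (h : ∀ x, x ∈ Z \ T ↔ -x ∈ T') :
    crossDiff Z T = crossSum T T' := by
  have : Z \ T = -T' := by
    ext x
    rw [h, Finset.mem_neg']
  rw [crossDiff, crossSum, this]
  refine Finset.prod_congr rfl fun b _ => ?_
  rw [← Finset.image_neg_eq_neg, Finset.prod_image (fun _ _ _ _ h => neg_injective h)]
  simp [sub_neg_eq_add]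

theorem crossSum_insert_left {T T' : Finset ℂ} {x : ℂ} (hx : x ∉ T) :
    crossSum (insert x T) T' = (∏ a ∈ T', (x + a)) * crossSum T T' := by
  rw [crossSum, Finset.prod_insert hx, crossSum]

theorem crossSum_insert_right {T T' : Finset ℂ} {x : ℂ} (hx : x ∉ T') :
    crossSum T (insert x T') = (∏ b ∈ T, (b + x)) * crossSum T T' := by
  rw [crossSum_comm, crossSum_insert_left hx, crossSum_comm]
  simp only [add_comm]

section

variable {P : Finset ℂ} (hP : ∀ b ∈ P, 0 < b.re)
include hP

theorem I_notMem : Complex.I ∉ P := fun h => by simpa using hP _ h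

theorem neg_I_notMem : -Complex.I ∉ P := fun h => by simpa using hP _ h

theorem neg_notMem {b : ℂ} (hb : b ∈ P) : -b ∉ P := fun h => by
  have h1 := hP _ hb
  have h2 := hP _ h
  rw [Complex.neg_re] at h2
  linarith

/-- The complement of `P ∪ {i}` is its own negative. The pair `(i, i)` contributes `2i`, and the two
mixed products give the square. -/
theorem crossDiff_insert_I :
    crossDiff (symmSet P) (insert Complex.I P) =
      crossSum P P * (∏ b ∈ P, (b + Complex.I)) ^ 2 * (2 * Complex.I) := by
  have hI := I_notMem hP
  rw [crossDiff_eq_crossSum (T' := insert Complex.I P), crossSum_insert_left hI,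
    crossSum_insert_right hI, Finset.prod_insert hI]
  · simp only [add_comm Complex.I]
    ring
  · intro x
    have hI' := neg_I_notMem hP
    have hI2 : Complex.I ≠ -Complex.I := by
      rw [Ne, self_eq_neg]; exact Complex.I_ne_zero
    have := @neg_notMem P hP (-x)
    rw [Finset.mem_sdiff, mem_symmSet, Finset.mem_insert, Finset.mem_insert, neg_eq_iff_eq_neg]
    rw [neg_neg] at this
    by_cases h1 : x = Complex.I
    · subst h1; tauto
    · by_cases h2 : x = -Complex.I
      · subst h2; tauto
      · tauto

theorem crossDiff_insert_neg_I :
    crossDiff (symmSet P) (insert (-Complex.I) P) =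
      -(crossSum P P * (∏ b ∈ P, (b - Complex.I)) ^ 2 * (2 * Complex.I)) := by
  have hI := neg_I_notMem hP
  rw [crossDiff_eq_crossSum (T' := insert (-Complex.I) P), crossSum_insert_left hI,
    crossSum_insert_right hI, Finset.prod_insert hI]
  · simp only [add_comm (-Complex.I), ← sub_eq_add_neg]
    ring
  · intro x
    have hI' := I_notMem hP
    have hI2 : Complex.I ≠ -Complex.I := by
      rw [Ne, self_eq_neg]; exact Complex.I_ne_zero
    have := @neg_notMem P hP (-x)
    rw [Finset.mem_sdiff, mem_symmSet, Finset.mem_insert, Finset.mem_insert, neg_inj]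
    rw [neg_neg] at this
    by_cases h1 : x = Complex.I
    · subst h1; tauto
    · by_cases h2 : x = -Complex.I
      · subst h2; rw [neg_neg] at *; tauto
      · tauto

/-- Both sides contain the product of sums over `P` and `P.erase p`. The factor `p ^ 2 + 1` is `(-p
+ i)(-p - i)`. The identity is cleared of denominators. -/
theorem crossSum_insert_neg {p : ℂ} (hp : p ∈ P) :
    crossSum (insert (-p) P) (insert Complex.I (insert (-Complex.I) (P.erase p))) *
      (2 * p * ∏ a ∈ P.erase p, (a + p)) =
    crossSum P P * (∏ b ∈ P, (b + Complex.I)) * (∏ b ∈ P, (b - Complex.I)) *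
      (∏ a ∈ P.erase p, (a - p)) * (p ^ 2 + 1) := by
  have hI := I_notMem hP
  have hI' := neg_I_notMem hP
  have hI2 : Complex.I ≠ -Complex.I := by
    rw [Ne, self_eq_neg]; exact Complex.I_ne_zero
  have h1 : -Complex.I ∉ P.erase p := fun h => hI' (Finset.mem_of_mem_erase h)
  have h2 : Complex.I ∉ insert (-Complex.I) (P.erase p) := fun h => by
    rcases Finset.mem_insert.1 h with h | h
    · exact hI2 h
    · exact hI (Finset.mem_of_mem_erase h)
  have hPP : crossSum P P = (2 * p * ∏ a ∈ P.erase p, (a + p)) * crossSum P (P.erase p) := by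
    conv_lhs => rw [← Finset.insert_erase hp]
    rw [crossSum_insert_right (Finset.notMem_erase p P), Finset.insert_erase hp,
      ← Finset.mul_prod_erase P _ hp]
    ring
  rw [crossSum_insert_left (neg_notMem hP hp), crossSum_insert_right h2, crossSum_insert_right h1,
    Finset.prod_insert h2, Finset.prod_insert h1, hPP]
  simp only [← sub_eq_add_neg, add_comm (-p)]
  linear_combination (-1 : ℂ) * (2 * p * ∏ a ∈ P.erase p, (a + p)) * crossSum P (P.erase p) *
    (∏ b ∈ P, (b + Complex.I)) * (∏ b ∈ P, (b - Complex.I)) *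
      (∏ a ∈ P.erase p, (a - p)) * Complex.I_sq

theorem crossDiff_insert_neg {p : ℂ} (hp : p ∈ P) :
    crossDiff (symmSet P) (insert (-p) P) =
      crossSum (insert (-p) P) (insert Complex.I (insert (-Complex.I) (P.erase p))) := by
  refine crossDiff_eq_crossSum fun x => ?_
  have h := @neg_notMem P hP (-x)
  have hI' := neg_I_notMem hP
  have hI := I_notMem hP
  have hx : x = -p ↔ -x = p := by rw [neg_eq_iff_eq_neg]
  have e1 : -x = Complex.I ↔ x = -Complex.I := neg_eq_iff_eq_neg
  rw [neg_neg] at h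
  have h3 : x = Complex.I → x ∉ P ∧ -x ∉ P := by rintro rfl; exact ⟨hI, hI'⟩
  have h4 : x = -Complex.I → x ∉ P ∧ -x ∉ P := by rintro rfl; rw [neg_neg]; exact ⟨hI', hI⟩
  have h5 : -x = p → -x ∈ P := fun h => h ▸ hp
  simp only [Finset.mem_sdiff, mem_symmSet, Finset.mem_insert, Finset.mem_erase, hx, e1, neg_inj]
  tauto

/-- This set and `P ∪ {-p}` are complementary up to negation, so the two have the same difference
product and their terms add up. -/
theorem crossDiff_erase {p : ℂ} (hp : p ∈ P) :
    crossDiff (symmSet P) (insert Complex.I (insert (-Complex.I) (P.erase p))) =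
      crossSum (insert (-p) P) (insert Complex.I (insert (-Complex.I) (P.erase p))) := by
  rw [crossSum_comm]
  refine crossDiff_eq_crossSum fun x => ?_
  have h := @neg_notMem P hP (-x)
  have hI' := neg_I_notMem hP
  have hI := I_notMem hP
  rw [neg_neg] at h
  have h3 : x = Complex.I → x ∉ P ∧ -x ∉ P := by rintro rfl; exact ⟨hI, hI'⟩
  have h4 : x = -Complex.I → x ∉ P ∧ -x ∉ P := by rintro rfl; rw [neg_neg]; exact ⟨hI', hI⟩
  have h5 : x = p → x ∈ P := fun h => h ▸ hp
  simp only [Finset.mem_sdiff, mem_symmSet, Finset.mem_insert, Finset.mem_erase, neg_inj]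
  tauto

/-! ### Loss in the exponent and the dominant subsets -/

/-- A subset `T` of `symmSet P` compared with `P`: the loss in the real part of the sum, and the
balance of cardinalities. -/
theorem re_sum_add_defect {T : Finset ℂ} (hT : T ⊆ symmSet P) :
    (∑ b ∈ T, b.re) + ∑ b ∈ P \ T, b.re + ∑ b ∈ P.filter (-· ∈ T), b.re = ∑ b ∈ P, b.re ∧
    T.card + (P \ T).card = P.card + (P.filter (-· ∈ T)).card +
      (T ∩ {Complex.I, -Complex.I}).card := by
  have hI' := neg_I_notMem hP
  have hI := I_notMem hP
  have hd1 : Disjoint (P ∩ T) (-(P.filter (-· ∈ T))) := by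
    rw [Finset.disjoint_left]
    intro x hx hx'
    rw [Finset.mem_neg', Finset.mem_filter] at hx'
    exact neg_notMem hP (Finset.mem_inter.1 hx).1 hx'.1
  have hd2 : Disjoint (P ∩ T ∪ -(P.filter (-· ∈ T))) (T ∩ {Complex.I, -Complex.I}) := by
    rw [Finset.disjoint_left]
    intro x hx hx'
    simp only [Finset.mem_union, Finset.mem_inter, Finset.mem_neg', Finset.mem_filter,
      Finset.mem_insert, Finset.mem_singleton] at hx hx'
    rcases hx' with ⟨_, rfl | rfl⟩ <;> simp_all
  have hU : T = P ∩ T ∪ -(P.filter (-· ∈ T)) ∪ T ∩ {Complex.I, -Complex.I} := by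
    ext x
    have := @hT x
    rw [mem_symmSet] at this
    simp only [Finset.mem_union, Finset.mem_inter, Finset.mem_neg', Finset.mem_filter,
      Finset.mem_insert, Finset.mem_singleton, neg_neg]
    tauto
  constructor
  · have hE : ∑ b ∈ T ∩ {Complex.I, -Complex.I}, b.re = 0 := by
      refine Finset.sum_eq_zero fun b hb => ?_
      simp only [Finset.mem_inter, Finset.mem_insert, Finset.mem_singleton] at hb
      rcases hb with ⟨_, rfl | rfl⟩ <;> simp
    conv_lhs => enter [1, 1, 1]; rw [hU]
    rw [Finset.sum_union hd2, Finset.sum_union hd1, hE, ← Finset.image_neg_eq_neg,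
      Finset.sum_image (fun _ _ _ _ h => neg_injective h),
      ← Finset.sum_inter_add_sum_sdiff P T Complex.re]
    simp only [Complex.neg_re, Finset.sum_neg_distrib]
    ring
  · have h := congrArg Finset.card hU
    rw [Finset.card_union_of_disjoint hd2, Finset.card_union_of_disjoint hd1,
      Finset.card_neg] at h
    have := Finset.card_inter_add_card_sdiff P T
    omega

/-- Apart from six dominant subsets, the subsets of `symmSet P` of size `P.card + 1` have sums with
smaller real part. -/
theorem re_sum_le_of_not_dominant {p q : ℂ} {c c' : ℝ} (hc0 : 0 ≤ c) (hc : ∀ b ∈ P, c ≤ b.re)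
    (hc' : ∀ b ∈ P, b ≠ p → b ≠ q → c' ≤ b.re) (hcc : c' ≤ 2 * c) {T : Finset ℂ}
    (hT : T ⊆ symmSet P) (hcard : T.card = P.card + 1)
    (h1 : T ≠ insert Complex.I P) (h2 : T ≠ insert (-Complex.I) P)
    (h3 : ∀ t, t = p ∨ t = q → T ≠ insert Complex.I (insert (-Complex.I) (P.erase t)))
    (h4 : ∀ t, t = p ∨ t = q → T ≠ insert (-t) P) :
    ∑ b ∈ T, b.re ≤ ∑ b ∈ P, b.re - c' := by
  obtain ⟨hsum, hc2⟩ := re_sum_add_defect hP hT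
  have hmem : ∀ x, x ∈ T → x ∈ P ∨ -x ∈ P ∨ x = Complex.I ∨ x = -Complex.I := fun x hx =>
    mem_symmSet.1 (hT hx)
  have hI' := neg_I_notMem hP
  have hI := I_notMem hP
  have hI2 : Complex.I ≠ -Complex.I := by
    rw [Ne, self_eq_neg]; exact Complex.I_ne_zero
  have hUle : c * (P \ T).card ≤ ∑ b ∈ P \ T, b.re := by
    have := Finset.card_nsmul_le_sum (P \ T) Complex.re c
      fun b hb => hc b (Finset.mem_sdiff.1 hb).1
    rwa [nsmul_eq_mul, mul_comm] at this
  have hWle : c * (P.filter (-· ∈ T)).card ≤ ∑ b ∈ P.filter (-· ∈ T), b.re := by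
    have := Finset.card_nsmul_le_sum (P.filter (-· ∈ T)) Complex.re c
      fun b hb => hc b (Finset.mem_filter.1 hb).1
    rwa [nsmul_eq_mul, mul_comm] at this
  have hU0 : (P \ T).card = 0 → ∀ x ∈ P, x ∈ T := fun h x hx => by
    by_contra hxT
    have := Finset.card_eq_zero.1 h
    have hx' := Finset.mem_sdiff.2 ⟨hx, hxT⟩
    rw [this] at hx'
    exact absurd hx' (Finset.notMem_empty x)
  have hW0 : (P.filter (-· ∈ T)).card = 0 → ∀ x ∈ P, -x ∉ T := fun h x hx hxT => by
    have := Finset.card_eq_zero.1 h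
    have hx' : x ∈ P.filter (-· ∈ T) := Finset.mem_filter.2 ⟨hx, hxT⟩
    rw [this] at hx'
    exact absurd hx' (Finset.notMem_empty x)
  have hW0' : (P.filter (-· ∈ T)).card = 0 → ∀ x ∈ T, -x ∉ P := fun h x hx hxP =>
    hW0 h _ hxP (by rwa [neg_neg])
  have hEmem : ∀ x, x ∈ T ∩ {Complex.I, -Complex.I} ↔
      x ∈ T ∧ (x = Complex.I ∨ x = -Complex.I) := by simp
  -- With `u` elements of `P` missing, `w` negatives present and `e` of `±i` present, the
  -- cardinality gives `u + 1 = w + e`. So `(u, w) = (0, 0), (0, 1), (1, 0)` force `e = 1, 0, 2` and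
  -- determine the shape of `T`. If `u + w ≥ 2`, the loss is at least `2 * c`.
  rcases Nat.lt_or_ge ((P \ T).card + (P.filter (-· ∈ T)).card) 2 with hlt | hge
  · rcases Nat.eq_zero_or_pos (P \ T).card with hu | hu
    · rcases Nat.eq_zero_or_pos (P.filter (-· ∈ T)).card with hw | hw
      · exfalso
        obtain ⟨x, hx⟩ := Finset.card_eq_one.1
          (show (T ∩ {Complex.I, -Complex.I}).card = 1 by omega)
        have hxs : ∀ y, y ∈ T ∧ (y = Complex.I ∨ y = -Complex.I) ↔ y = x := fun y => by
          rw [← hEmem, hx, Finset.mem_singleton]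
        have hTe : T = insert x P := by
          ext y
          rw [Finset.mem_insert]
          have a1 := hmem y
          have a2 := hW0' hw y
          have a3 := hU0 hu y
          have a4 := hxs y
          clear * - a1 a2 a3 a4
          grind
        rcases ((hxs x).2 rfl).2 with h | h
        · exact h1 (h ▸ hTe)
        · exact h2 (h ▸ hTe)
      · obtain ⟨w, hw'⟩ := Finset.card_eq_one.1
          (show (P.filter (-· ∈ T)).card = 1 by omega)
        have hE : T ∩ {Complex.I, -Complex.I} = ∅ := Finset.card_eq_zero.1 (by omega)
        have hws : ∀ y, (y ∈ P ∧ -y ∈ T) ↔ y = w := fun y => by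
          rw [← Finset.mem_singleton, ← hw', Finset.mem_filter]
        have hTe : T = insert (-w) P := by
          ext y
          rw [Finset.mem_insert]
          have a1 := hmem y
          have a2 := hws (-y)
          rw [neg_neg, neg_eq_iff_eq_neg] at a2
          have a3 := hU0 hu y
          have a4 := hEmem y
          rw [hE] at a4
          have a5 := Finset.notMem_empty y
          clear * - a1 a2 a3 a4 a5
          grind
        have hwp : w ≠ p := fun h => h4 w (Or.inl h) hTe
        have hwq : w ≠ q := fun h => h4 w (Or.inr h) hTe
        have := hc' w ((hws w).2 rfl).1 hwp hwq
        rw [hw', Finset.sum_singleton, Finset.card_eq_zero.1 hu, Finset.sum_empty] at hsum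
        linarith
    · have hw : (P.filter (-· ∈ T)).card = 0 := by omega
      obtain ⟨u, hu'⟩ := Finset.card_eq_one.1 (show (P \ T).card = 1 by omega)
      have hE : T ∩ {Complex.I, -Complex.I} = {Complex.I, -Complex.I} :=
        Finset.eq_of_subset_of_card_le Finset.inter_subset_right
          (by rw [Finset.card_pair hI2]; omega)
      have hus : ∀ y, (y ∈ P ∧ y ∉ T) ↔ y = u := fun y => by
        rw [← Finset.mem_singleton, ← hu', Finset.mem_sdiff]
      have hTe : T = insert Complex.I (insert (-Complex.I) (P.erase u)) := by
        ext y
        rw [Finset.mem_insert, Finset.mem_insert, Finset.mem_erase]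
        have a1 := hmem y
        have a2 := hW0' hw y
        have a3 := hus y
        have a4 := hEmem y
        rw [hE, Finset.mem_insert, Finset.mem_singleton] at a4
        clear * - a1 a2 a3 a4
        grind
      have hup : u ≠ p := fun h => h3 u (Or.inl h) hTe
      have huq : u ≠ q := fun h => h3 u (Or.inr h) hTe
      have := hc' u ((hus u).2 rfl).1 hup huq
      rw [hu', Finset.sum_singleton, Finset.card_eq_zero.1 hw, Finset.sum_empty] at hsum
      linarith
  · have : (2 : ℝ) ≤ ((P \ T).card : ℝ) + ((P.filter (-· ∈ T)).card : ℝ) := by exact_mod_cast hge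
    nlinarith

end

/-! ### Asymptotics of the exponential sum -/

theorem exp_isBigO_of_re_le {w : ℂ} {g : ℝ} (h : w.re ≤ g) (c : ℂ) :
    (fun μ : ℝ => c * Complex.exp (μ * w)) =O[atTop] fun μ : ℝ => Real.exp (g * μ) := by
  refine IsBigO.of_bound ‖c‖ ?_
  filter_upwards [eventually_ge_atTop 0] with μ hμ
  rw [norm_mul, Complex.norm_exp, Real.norm_eq_abs, Real.abs_exp]
  refine mul_le_mul_of_nonneg_left (Real.exp_le_exp.2 ?_) (norm_nonneg c)
  rw [Complex.re_ofReal_mul, mul_comm]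
  exact mul_le_mul_of_nonneg_right h hμ

section

variable {P : Finset ℂ} (hP : ∀ b ∈ P, 0 < b.re)
include hP

theorem sum_insert_I_neg_I_erase {t : ℂ} (ht : t ∈ P) :
    ∑ b ∈ insert Complex.I (insert (-Complex.I) (P.erase t)), b = ∑ b ∈ P, b - t := by
  have hI2 : Complex.I ≠ -Complex.I := by
    rw [Ne, self_eq_neg]; exact Complex.I_ne_zero
  have h1 : -Complex.I ∉ P.erase t := fun h => neg_I_notMem hP (Finset.mem_of_mem_erase h)
  have h2 : Complex.I ∉ insert (-Complex.I) (P.erase t) := fun h => by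
    rcases Finset.mem_insert.1 h with h | h
    · exact hI2 h
    · exact I_notMem hP (Finset.mem_of_mem_erase h)
  rw [Finset.sum_insert h2, Finset.sum_insert h1, ← Finset.add_sum_erase P _ ht]
  ring

theorem sum_insert_neg {t : ℂ} (ht : t ∈ P) : ∑ b ∈ insert (-t) P, b = ∑ b ∈ P, b - t := by
  rw [Finset.sum_insert (neg_notMem hP ht)]
  ring

/-- Only the six dominant subsets contribute to the exponential sum, up to an error term. -/
theorem sum_exp_sub_dominant_isBigO {p q : ℂ} (hp : p ∈ P) (hq : q ∈ P) (hpq : p ≠ q)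
    {c c' : ℝ} (hc0 : 0 ≤ c) (hc : ∀ b ∈ P, c ≤ b.re)
    (hc' : ∀ b ∈ P, b ≠ p → b ≠ q → c' ≤ b.re) (hcc : c' ≤ 2 * c) (f : Finset ℂ → ℂ) :
    (fun μ : ℝ => ∑ T ∈ (symmSet P).powersetCard (P.card + 1),
        f T * Complex.exp (μ * ∑ b ∈ T, b) -
      (f (insert Complex.I P) * Complex.exp (μ * (Complex.I + ∑ b ∈ P, b)) +
        (f (insert (-Complex.I) P) * Complex.exp (μ * (-Complex.I + ∑ b ∈ P, b)) +
        (f (insert Complex.I (insert (-Complex.I) (P.erase p))) *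
            Complex.exp (μ * (∑ b ∈ P, b - p)) +
        (f (insert Complex.I (insert (-Complex.I) (P.erase q))) *
            Complex.exp (μ * (∑ b ∈ P, b - q)) +
        (f (insert (-p) P) * Complex.exp (μ * (∑ b ∈ P, b - p)) +
          f (insert (-q) P) * Complex.exp (μ * (∑ b ∈ P, b - q))))))))
      =O[atTop] fun μ : ℝ => Real.exp ((∑ b ∈ P, b.re - c') * μ) := by
  have hI' := neg_I_notMem hP
  have hI := I_notMem hP
  have hI2 : Complex.I ≠ -Complex.I := by
    rw [Ne, self_eq_neg]; exact Complex.I_ne_zero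
  have hnp := neg_notMem hP hp
  have hnq := neg_notMem hP hq
  have hIp : Complex.I ≠ -p := fun h => hI' (by rw [h, neg_neg]; exact hp)
  have hIq : Complex.I ≠ -q := fun h => hI' (by rw [h, neg_neg]; exact hq)
  have hIp' : -Complex.I ≠ -p := fun h => hI (neg_injective h ▸ hp)
  have hIq' : -Complex.I ≠ -q := fun h => hI (neg_injective h ▸ hq)
  have hnpq : -p ≠ -q := fun h => hpq (neg_injective h)
  have hqI : q ≠ Complex.I := fun h => hI (h ▸ hq)
  have hqI' : q ≠ -Complex.I := fun h => hI' (h ▸ hq)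
  set S₁ := insert Complex.I P with hS₁
  set S₂ := insert (-Complex.I) P with hS₂
  set S₃ := insert Complex.I (insert (-Complex.I) (P.erase p)) with hS₃
  set S₄ := insert Complex.I (insert (-Complex.I) (P.erase q)) with hS₄
  set S₅ := insert (-p) P with hS₅
  set S₆ := insert (-q) P with hS₆
  have ne_of_mem : ∀ {A B : Finset ℂ} (x : ℂ), x ∈ A → x ∉ B → A ≠ B :=
    fun x h1 h2 h => h2 (h ▸ h1)
  -- Pairwise distinctness lets the sum over the six sets split into six terms; each pair is
  -- separated by one element.
  have d12 : S₁ ≠ S₂ := ne_of_mem Complex.I (by simp [hS₁]) (by simp [hS₂, hI, hI2])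
  have d13 : S₁ ≠ S₃ := (ne_of_mem (-Complex.I) (by simp [hS₃]) (by simp [hS₁, hI', hI2.symm])).symm
  have d14 : S₁ ≠ S₄ := (ne_of_mem (-Complex.I) (by simp [hS₄]) (by simp [hS₁, hI', hI2.symm])).symm
  have d15 : S₁ ≠ S₅ := ne_of_mem Complex.I (by simp [hS₁]) (by simp [hS₅, hI, hIp])
  have d16 : S₁ ≠ S₆ := ne_of_mem Complex.I (by simp [hS₁]) (by simp [hS₆, hI, hIq])
  have d23 : S₂ ≠ S₃ := (ne_of_mem Complex.I (by simp [hS₃]) (by simp [hS₂, hI, hI2])).symm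
  have d24 : S₂ ≠ S₄ := (ne_of_mem Complex.I (by simp [hS₄]) (by simp [hS₂, hI, hI2])).symm
  have d25 : S₂ ≠ S₅ := ne_of_mem (-Complex.I) (by simp [hS₂])
    (by rw [hS₅, Finset.mem_insert]; tauto)
  have d26 : S₂ ≠ S₆ := ne_of_mem (-Complex.I) (by simp [hS₂])
    (by rw [hS₆, Finset.mem_insert]; tauto)
  have d34 : S₃ ≠ S₄ := ne_of_mem q (by simp [hS₃, hq, hpq.symm]) (by simp [hS₄, hqI, hqI'])
  have d35 : S₃ ≠ S₅ := ne_of_mem Complex.I (by simp [hS₃]) (by simp [hS₅, hI, hIp])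
  have d36 : S₃ ≠ S₆ := ne_of_mem Complex.I (by simp [hS₃]) (by simp [hS₆, hI, hIq])
  have d45 : S₄ ≠ S₅ := ne_of_mem Complex.I (by simp [hS₄]) (by simp [hS₅, hI, hIp])
  have d46 : S₄ ≠ S₆ := ne_of_mem Complex.I (by simp [hS₄]) (by simp [hS₆, hI, hIq])
  have d56 : S₅ ≠ S₆ := ne_of_mem (-p) (by simp [hS₅])
    (by rw [hS₆, Finset.mem_insert]; tauto)
  have hPsub : P ⊆ symmSet P := fun x hx => mem_symmSet.2 (Or.inl hx)
  have hIm : Complex.I ∈ symmSet P := mem_symmSet.2 (by simp)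
  have hIm' : -Complex.I ∈ symmSet P := mem_symmSet.2 (by simp)
  have hE : ∀ t ∈ P, insert Complex.I (insert (-Complex.I) (P.erase t)) ∈
      (symmSet P).powersetCard (P.card + 1) := fun t ht => by
    have h1 : -Complex.I ∉ P.erase t := fun h => hI' (Finset.mem_of_mem_erase h)
    have h2 : Complex.I ∉ insert (-Complex.I) (P.erase t) := fun h => by
      rcases Finset.mem_insert.1 h with h | h
      · exact hI2 h
      · exact hI (Finset.mem_of_mem_erase h)
    refine Finset.mem_powersetCard.2 ⟨Finset.insert_subset hIm (Finset.insert_subset hIm'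
      ((Finset.erase_subset t P).trans hPsub)), ?_⟩
    rw [Finset.card_insert_of_notMem h2, Finset.card_insert_of_notMem h1,
      Finset.card_erase_add_one ht]
  have hN : ∀ x ∈ symmSet P, x ∉ P → insert x P ∈ (symmSet P).powersetCard (P.card + 1) :=
    fun x hx hxP => Finset.mem_powersetCard.2
      ⟨Finset.insert_subset hx hPsub, Finset.card_insert_of_notMem hxP⟩
  have hsub : ({S₁, S₂, S₃, S₄, S₅, S₆} : Finset (Finset ℂ)) ⊆
      (symmSet P).powersetCard (P.card + 1) := by
    intro T hT
    simp only [Finset.mem_insert, Finset.mem_singleton] at hT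
    rcases hT with rfl | rfl | rfl | rfl | rfl | rfl
    · exact hN _ hIm hI
    · exact hN _ hIm' hI'
    · exact hE p hp
    · exact hE q hq
    · exact hN _ (mem_symmSet.2 (by simp [hp])) hnp
    · exact hN _ (mem_symmSet.2 (by simp [hq])) hnq
  have hrest : (fun μ : ℝ => ∑ T ∈ (symmSet P).powersetCard (P.card + 1) \
      {S₁, S₂, S₃, S₄, S₅, S₆}, f T * Complex.exp (μ * ∑ b ∈ T, b))
      =O[atTop] fun μ : ℝ => Real.exp ((∑ b ∈ P, b.re - c') * μ) := by
    refine IsBigO.fun_sum fun T hT => exp_isBigO_of_re_le ?_ _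
    obtain ⟨hT1, hT2⟩ := Finset.mem_sdiff.1 hT
    obtain ⟨hTs, hTc⟩ := Finset.mem_powersetCard.1 hT1
    simp only [Finset.mem_insert, Finset.mem_singleton, not_or] at hT2
    obtain ⟨e1, e2, e3, e4, e5, e6⟩ := hT2
    rw [Complex.re_sum]
    refine re_sum_le_of_not_dominant hP hc0 hc hc' hcc hTs hTc e1 e2 ?_ ?_
    · rintro t (rfl | rfl)
      · exact e3
      · exact e4
    · rintro t (rfl | rfl)
      · exact e5
      · exact e6
  refine hrest.congr_left fun μ => ?_
  rw [eq_sub_iff_add_eq, ← Finset.sum_sdiff hsub]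
  congr 1
  have n1 : S₁ ∉ ({S₂, S₃, S₄, S₅, S₆} : Finset (Finset ℂ)) := by simp [d12, d13, d14, d15, d16]
  have n2 : S₂ ∉ ({S₃, S₄, S₅, S₆} : Finset (Finset ℂ)) := by simp [d23, d24, d25, d26]
  have n3 : S₃ ∉ ({S₄, S₅, S₆} : Finset (Finset ℂ)) := by simp [d34, d35, d36]
  have n4 : S₄ ∉ ({S₅, S₆} : Finset (Finset ℂ)) := by simp [d45, d46]
  have n5 : S₅ ∉ ({S₆} : Finset (Finset ℂ)) := by simp [d56]
  rw [Finset.sum_insert n1, Finset.sum_insert n2, Finset.sum_insert n3, Finset.sum_insert n4,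
    Finset.sum_insert n5, Finset.sum_singleton, hS₁, hS₂, hS₃, hS₄, hS₅, hS₆,
    Finset.sum_insert hI, Finset.sum_insert hI', sum_insert_I_neg_I_erase hP hp,
    sum_insert_I_neg_I_erase hP hq, sum_insert_neg hP hp, sum_insert_neg hP hq]

/-- The sign `s` enters once from `hA` and once from `ht`, so it cancels. For `p` on the unit circle
with real part `c`, `hc` is `p ^ 2 + 1 = p * (p + conj p)`. -/
theorem crossSum_insert_neg_eq {p : ℂ} (hp : p ∈ P) {s t c : ℂ} (hs : s ^ 2 = 1)
    (hA : ∏ b ∈ P, (b - Complex.I) = s * ∏ b ∈ P, (b + Complex.I))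
    (ht : ∏ a ∈ P.erase p, (a - p) = s * Complex.I * t * ∏ a ∈ P.erase p, (a + p))
    (hc : p ^ 2 + 1 = 2 * p * c) :
    crossSum (insert (-p) P) (insert Complex.I (insert (-Complex.I) (P.erase p))) =
      crossSum P P * (∏ b ∈ P, (b + Complex.I)) ^ 2 * (Complex.I * t * c) := by
  have hp0 : p ≠ 0 := by
    rintro rfl
    simpa using hP _ hp
  have hprod : ∏ a ∈ P.erase p, (a + p) ≠ 0 := by
    refine Finset.prod_ne_zero_iff.2 fun a ha h => ?_
    have h1 := hP _ (Finset.mem_of_mem_erase ha)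
    have h2 := hP _ hp
    have := congrArg Complex.re h
    rw [Complex.add_re, Complex.zero_re] at this
    linarith
  apply mul_right_cancel₀ (mul_ne_zero (mul_ne_zero two_ne_zero hp0) hprod)
  rw [crossSum_insert_neg hP hp, hA, ht, hc]
  linear_combination crossSum P P * (∏ b ∈ P, (b + Complex.I)) ^ 2 * (Complex.I * t * c) *
    (2 * p * ∏ a ∈ P.erase p, (a + p)) * hs

/-- The dominant part of the exponential sum, when `P` is symmetric enough for the leading
coefficients to be antisymmetric under complex conjugation. -/
theorem sum_exp_sub_sin_isBigO {p q : ℂ} (hp : p ∈ P) (hq : q ∈ P) (hpq : p ≠ q)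
    {c c' t y g : ℝ} (hc0 : 0 ≤ c) (hc : ∀ b ∈ P, c ≤ b.re)
    (hc' : ∀ b ∈ P, b ≠ p → b ≠ q → c' ≤ b.re) (hcc : c' ≤ 2 * c) {s : ℂ} (hs : s ^ 2 = 1)
    (hA : ∏ b ∈ P, (b - Complex.I) = s * ∏ b ∈ P, (b + Complex.I))
    (htp : ∏ a ∈ P.erase p, (a - p) = s * Complex.I * t * ∏ a ∈ P.erase p, (a + p))
    (htq : ∏ a ∈ P.erase q, (a - q) = s * Complex.I * (-t) * ∏ a ∈ P.erase q, (a + q))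
    (hcp : p ^ 2 + 1 = 2 * p * c) (hcq : q ^ 2 + 1 = 2 * q * c)
    (hpy : p = c + y * Complex.I) (hqy : q = c - y * Complex.I) (hg : ∑ b ∈ P, b = g)
    {K V : ℂ} (hK : K * (crossSum P P * (∏ b ∈ P, (b + Complex.I)) ^ 2) = V) :
    (fun μ : ℝ => ∑ T ∈ (symmSet P).powersetCard (P.card + 1),
        V / crossDiff (symmSet P) T * Complex.exp (μ * ∑ b ∈ T, b) -
      (K * (Real.exp (g * μ) : ℂ) * (Real.sin μ : ℂ) +
        (-4 * K / (t * c)) * (Real.exp ((g - c) * μ) : ℂ) * (Real.sin (y * μ) : ℂ)))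
      =O[atTop] fun μ : ℝ => Real.exp ((g - c') * μ) := by
  have hmain := sum_exp_sub_dominant_isBigO hP hp hq hpq hc0 hc hc' hcc
    (fun T => V / crossDiff (symmSet P) T)
  have hgre : ∑ b ∈ P, b.re = g := by rw [← Complex.re_sum, hg, Complex.ofReal_re]
  rw [hgre, hg] at hmain
  refine hmain.congr_left fun μ => ?_
  congr 1
  have hRp := crossDiff_ne_zero (symmSet P) (insert (-p) P)
  have hR1 := crossDiff_ne_zero (symmSet P) (insert Complex.I P)
  simp only [crossDiff_insert_I hP, crossDiff_insert_neg_I hP, crossDiff_erase hP hp,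
    crossDiff_erase hP hq, crossDiff_insert_neg hP hp, crossDiff_insert_neg hP hq,
    crossSum_insert_neg_eq hP hp hs hA htp hcp,
    crossSum_insert_neg_eq hP hq hs hA htq hcq] at hRp hR1 ⊢
  -- The two leading denominators become `2iD` and `-2iD`, so their exponentials combine to a sine;
  -- `t` and `-t` do the same for `p` and `q`.
  have hA2 : (∏ b ∈ P, (b - Complex.I)) ^ 2 = (∏ b ∈ P, (b + Complex.I)) ^ 2 := by
    rw [hA, mul_pow, hs, one_mul]
  rw [hA2]
  set D := crossSum P P * (∏ b ∈ P, (b + Complex.I)) ^ 2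
  have hD : D ≠ 0 := left_ne_zero_of_mul hR1
  -- That `t` and `c` are nonzero is read off from a nonvanishing difference product.
  have ht : (t : ℂ) ≠ 0 := right_ne_zero_of_mul (left_ne_zero_of_mul (right_ne_zero_of_mul hRp))
  have hc1 : (c : ℂ) ≠ 0 := right_ne_zero_of_mul (right_ne_zero_of_mul hRp)
  have hI := Complex.I_ne_zero
  have e1 : Complex.exp (μ * (Complex.I + g)) =
      Complex.exp (g * μ) * Complex.exp (μ * Complex.I) := by rw [← Complex.exp_add]; ring_nf
  have e2 : Complex.exp (μ * (-Complex.I + g)) =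
      Complex.exp (g * μ) * Complex.exp (-μ * Complex.I) := by rw [← Complex.exp_add]; ring_nf
  have e3 : Complex.exp (μ * (g - p)) =
      Complex.exp ((g - c) * μ) * Complex.exp (-(y * μ) * Complex.I) := by
    rw [← Complex.exp_add, hpy]; ring_nf
  have e4 : Complex.exp (μ * (g - q)) =
      Complex.exp ((g - c) * μ) * Complex.exp ((y * μ) * Complex.I) := by
    rw [← Complex.exp_add, hqy]; ring_nf
  rw [e1, e2, e3, e4, ← hK]
  push_cast
  rw [Complex.sin, Complex.sin]
  field_simp
  ring_nf
  simp only [Complex.I_sq]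
  ring

end

/-! ### The roots of `z ^ (4k + 2) = -1` -/

/-- The arguments of the roots of `z ^ (4 k + 2) = -1` in the right half-plane, in increasing
order. -/
noncomputable def rightAngle (k m : ℕ) : ℝ := (2 * m + 1 - 2 * k) * (Real.pi / (2 * (2 * k + 1)))

/-- The roots of `z ^ (4 k + 2) = -1` in the right half-plane. -/
noncomputable def rightRoot (k m : ℕ) : ℂ := Complex.exp (rightAngle k m * Complex.I)

/-- The set of roots of `z ^ (4 k + 2) = -1` in the right half-plane. -/
noncomputable def rightRoots (k : ℕ) : Finset ℂ := (Finset.range (2 * k)).image (rightRoot k)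

theorem rightRoot_eq (k m : ℕ) :
    rightRoot k m = Real.cos (rightAngle k m) + Real.sin (rightAngle k m) * Complex.I := by
  rw [rightRoot, Complex.exp_mul_I, Complex.ofReal_cos, Complex.ofReal_sin]

theorem rightRoot_re (k m : ℕ) : (rightRoot k m).re = Real.cos (rightAngle k m) :=
  Complex.exp_ofReal_mul_I_re _

theorem rightAngle_reflect {k m : ℕ} (hm : m < 2 * k) :
    rightAngle k (2 * k - 1 - m) = -rightAngle k m := by
  have h : ((2 * k - 1 - m : ℕ) : ℝ) = 2 * k - 1 - m := by
    rw [Nat.cast_sub (by omega), Nat.cast_sub (by omega)]; push_cast; ring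
  rw [rightAngle, rightAngle, h]
  ring

theorem rightRoot_reflect {k m : ℕ} (hm : m < 2 * k) :
    rightRoot k (2 * k - 1 - m) = starRingEnd ℂ (rightRoot k m) := by
  rw [rightRoot, rightRoot, ← Complex.exp_conj, rightAngle_reflect hm]
  simp

theorem step_pos (k : ℕ) : 0 < Real.pi / (2 * (2 * (k : ℝ) + 1)) := by
  have := Real.pi_pos
  positivity

theorem step_mul (k : ℕ) :
    (2 * (k : ℝ) + 1) * (Real.pi / (2 * (2 * (k : ℝ) + 1))) = Real.pi / 2 := by
  have : (2 * (k : ℝ) + 1) ≠ 0 := by positivity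
  field_simp

theorem cos_rightAngle_pos {k m : ℕ} (hm : m < 2 * k) : 0 < Real.cos (rightAngle k m) := by
  have h1 := step_pos k
  have h2 := step_mul k
  have h3 : (m : ℝ) + 1 ≤ 2 * k := by exact_mod_cast hm
  have h4 : (0 : ℝ) ≤ m := Nat.cast_nonneg m
  refine Real.cos_pos_of_mem_Ioo ⟨?_, ?_⟩ <;> rw [rightAngle] <;> nlinarith

theorem rightRoots_re_pos (k : ℕ) : ∀ b ∈ rightRoots k, 0 < b.re := by
  intro b hb
  obtain ⟨m, hm, rfl⟩ := Finset.mem_image.1 hb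
  rw [rightRoot_re]
  exact cos_rightAngle_pos (Finset.mem_range.1 hm)

theorem rightRoot_mem {k m : ℕ} (hm : m < 2 * k) : rightRoot k m ∈ rightRoots k :=
  Finset.mem_image_of_mem _ (Finset.mem_range.2 hm)

theorem rootEps_pow (k n : ℕ) :
    rootEps (2 * k + 1) ^ n =
      Complex.exp (((n * (Real.pi / (2 * (2 * k + 1))) : ℝ) : ℂ) * Complex.I) := by
  rw [rootEps, ← Complex.exp_nat_mul]
  congr 1
  push_cast
  ring

theorem rootEps_isPrimitiveRoot {α : ℕ} (hα : α ≠ 0) : IsPrimitiveRoot (rootEps α) (4 * α) := by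
  have h := Complex.isPrimitiveRoot_exp (4 * α) (by omega)
  convert h using 1
  rw [rootEps]
  congr 1
  have : (α : ℂ) ≠ 0 := Nat.cast_ne_zero.2 hα
  push_cast
  field_simp
  norm_num

/-- The roots of `z ^ (2 α) = -1` in the order of the columns of `boundaryMatrix`. -/
noncomputable def rootEmbedding (α : ℕ) : Fin (2 * α) ↪ ℂ where
  toFun j := rootEps α ^ (2 * (j : ℕ) + 1)
  inj' i j h := by
    have hi := i.2
    have hj := j.2
    have := (rootEps_isPrimitiveRoot (α := α) (by omega)).pow_inj (by omega) (by omega) h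
    exact Fin.ext (by omega)

theorem boundaryMatrix_eq_stackedPowers (α : ℕ) (μ : ℝ) :
    boundaryMatrix α μ =
      stackedPowers α (rootEmbedding α) fun j => Complex.exp (μ * rootEmbedding α j) := rfl

theorem exp_mul_I_eq_of_add {x y : ℝ} (n : ℤ) (h : x = y + n * (2 * Real.pi)) :
    Complex.exp (x * Complex.I) = Complex.exp (y * Complex.I) := by
  rw [Complex.exp_eq_exp_iff_exists_int]
  refine ⟨n, ?_⟩
  rw [h]
  push_cast
  ring

theorem rootEmbedding_mem_symmSet (k : ℕ) (j : Fin (2 * (2 * k + 1))) :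
    rootEmbedding (2 * k + 1) j ∈ symmSet (rightRoots k) := by
  have hj := j.2
  have hπ := step_mul k
  set h := Real.pi / (2 * (2 * (k : ℝ) + 1)) with hh
  change rootEps (2 * k + 1) ^ (2 * (j : ℕ) + 1) ∈ _
  rw [rootEps_pow, ← hh, mem_symmSet]
  have key : ∀ m : ℕ, rightAngle k m = (2 * m + 1 - 2 * k) * h := fun m => rfl
  have hneg : ∀ x : ℝ, -Complex.exp (x * Complex.I) =
      Complex.exp ((x - Real.pi : ℝ) * Complex.I) := fun x => by
    rw [Complex.ofReal_sub, sub_mul, Complex.exp_sub, Complex.exp_pi_mul_I, div_neg, div_one]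
  have hI : Complex.I = Complex.exp ((Real.pi / 2 : ℝ) * Complex.I) := by
    push_cast
    rw [Complex.exp_pi_div_two_mul_I]
  -- `j = k` and `j = 3k + 1` give `i` and `-i`; beyond the latter the angle wraps around by `2π`.
  rcases lt_trichotomy (j : ℕ) k with h1 | h1 | h1
  · left
    convert rightRoot_mem (k := k) (m := (j : ℕ) + k) (by omega) using 1
    rw [rightRoot, key]
    push_cast
    ring_nf
  · right; right; left
    rw [h1]
    refine (congrArg (fun x : ℝ => Complex.exp (x * Complex.I)) ?_).trans hI.symm
    push_cast
    exact hπ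
  · rcases lt_trichotomy (j : ℕ) (3 * k + 1) with h2 | h2 | h2
    · right; left
      convert rightRoot_mem (k := k) (m := (j : ℕ) - k - 1) (by omega) using 1
      rw [hneg, rightRoot]
      congr 3
      rw [key, Nat.cast_sub (by omega), Nat.cast_sub (by omega)]
      push_cast
      linear_combination (2 : ℝ) * hπ
    · right; right; right
      rw [h2]
      refine (exp_mul_I_eq_of_add (y := Real.pi / 2 - Real.pi) 1 ?_).trans ?_
      · push_cast
        linear_combination (3 : ℝ) * hπ
      · rw [← hneg, ← hI]
    · left
      convert rightRoot_mem (k := k) (m := (j : ℕ) - (3 * k + 2)) (by omega) using 1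
      rw [rightRoot]
      apply exp_mul_I_eq_of_add 1
      rw [key, Nat.cast_sub (by omega)]
      push_cast
      linear_combination (4 : ℝ) * hπ

/-- By counting: `4k + 2` distinct roots lie in a set of at most `2 * (rightRoots k).card + 2 ≤ 4k +
2` elements, so equality holds throughout. Injectivity of `rightRoot` comes out of this as well. -/
theorem map_rootEmbedding_and_card (k : ℕ) :
    Finset.univ.map (rootEmbedding (2 * k + 1)) = symmSet (rightRoots k) ∧
      (rightRoots k).card = 2 * k := by
  have hsub : Finset.univ.map (rootEmbedding (2 * k + 1)) ⊆ symmSet (rightRoots k) := by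
    intro x hx
    obtain ⟨j, -, rfl⟩ := Finset.mem_map.1 hx
    exact rootEmbedding_mem_symmSet k j
  have hcard : (Finset.univ.map (rootEmbedding (2 * k + 1))).card = 2 * (2 * k + 1) := by simp
  have hle : (rightRoots k).card ≤ 2 * k := by
    exact Finset.card_image_le.trans (Finset.card_range _).le
  have hsymm : (symmSet (rightRoots k)).card ≤ 2 * (rightRoots k).card + 2 := by
    refine (Finset.card_union_le _ _).trans (Nat.add_le_add ((Finset.card_union_le _ _).trans ?_)
      Finset.card_le_two)
    rw [Finset.card_neg]
    omega
  have := Finset.card_le_card hsub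
  exact ⟨Finset.eq_of_subset_of_card_le hsub (by omega), by omega⟩

theorem rightRoot_injOn (k : ℕ) : Set.InjOn (rightRoot k) (Finset.range (2 * k)) := by
  rw [← Finset.card_image_iff, Finset.card_range]
  exact (map_rootEmbedding_and_card k).2

/-! ### Products over the right half-plane roots -/

theorem prod_rightRoots (k : ℕ) (f : ℂ → ℂ) :
    ∏ b ∈ rightRoots k, f b = ∏ m ∈ Finset.range (2 * k), f (rightRoot k m) :=
  Finset.prod_image (rightRoot_injOn k)

theorem prod_range_reflect_rightRoot (k : ℕ) (f : ℂ → ℂ) :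
    ∏ m ∈ Finset.range (2 * k), f (rightRoot k m) =
      ∏ m ∈ Finset.range (2 * k), f (starRingEnd ℂ (rightRoot k m)) := by
  rw [← Finset.prod_range_reflect]
  exact Finset.prod_congr rfl fun m hm => by rw [rightRoot_reflect (Finset.mem_range.1 hm)]

theorem rightRoot_mul_conj (k m : ℕ) : rightRoot k m * starRingEnd ℂ (rightRoot k m) = 1 := by
  rw [rightRoot, ← Complex.exp_conj, ← Complex.exp_add]
  simp

theorem rightRoot_add_conj (k m : ℕ) :
    rightRoot k m + starRingEnd ℂ (rightRoot k m) = 2 * Real.cos (rightAngle k m) := by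
  rw [Complex.add_conj, rightRoot_re]
  push_cast
  ring

theorem sum_rightAngle (k : ℕ) : ∑ m ∈ Finset.range (2 * k), rightAngle k m = 0 := by
  have h : ∑ m ∈ Finset.range (2 * k), rightAngle k m =
      ∑ m ∈ Finset.range (2 * k), -rightAngle k m := by
    rw [← Finset.sum_range_reflect]
    exact Finset.sum_congr rfl fun m hm => rightAngle_reflect (Finset.mem_range.1 hm)
  rw [Finset.sum_neg_distrib] at h
  linarith

theorem prod_rightRoot (k : ℕ) : ∏ m ∈ Finset.range (2 * k), rightRoot k m = 1 := by
  simp only [rightRoot]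
  rw [← Complex.exp_sum, ← Finset.sum_mul, ← Complex.ofReal_sum, sum_rightAngle]
  simp

/-- Let `X = ∏ (b + i)`, `Y = ∏ (b - i)`. Pairing `b` with its conjugate, `X² = ∏ 2i Re b`; also `X
Y = ∏ (b² + 1) = ∏ 2 b Re b`, and `∏ b = 1`. Dividing by `X` gives `Y = (-1) ^ k X`. -/
theorem prod_rightRoots_sub_I (k : ℕ) :
    ∏ b ∈ rightRoots k, (b - Complex.I) = (-1) ^ k * ∏ b ∈ rightRoots k, (b + Complex.I) := by
  have hne : ∏ b ∈ rightRoots k, (b + Complex.I) ≠ 0 := by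
    refine Finset.prod_ne_zero_iff.2 fun b hb h => ?_
    have h1 := rightRoots_re_pos k b hb
    have h2 := congrArg Complex.re h
    simp only [Complex.add_re, Complex.I_re, Complex.zero_re] at h2
    linarith
  rw [prod_rightRoots] at hne ⊢
  rw [prod_rightRoots]
  set X := ∏ m ∈ Finset.range (2 * k), (rightRoot k m + Complex.I) with hX
  set Y := ∏ m ∈ Finset.range (2 * k), (rightRoot k m - Complex.I) with hY
  set C := ∏ m ∈ Finset.range (2 * k), (Real.cos (rightAngle k m) : ℂ)
  have hXX : X * X = (-4) ^ k * C := by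
    conv_lhs => enter [2]; rw [hX, prod_range_reflect_rightRoot k (· + Complex.I)]
    rw [hX, ← Finset.prod_mul_distrib]
    have : ∀ m ∈ Finset.range (2 * k), (rightRoot k m + Complex.I) *
        (starRingEnd ℂ (rightRoot k m) + Complex.I) =
        (2 * Complex.I) * (Real.cos (rightAngle k m) : ℂ) := fun m _ => by
      linear_combination rightRoot_mul_conj k m + Complex.I * rightRoot_add_conj k m + Complex.I_sq
    rw [Finset.prod_congr rfl this, Finset.prod_mul_distrib, Finset.prod_const, Finset.card_range,
      pow_mul, mul_pow, Complex.I_sq,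
      show (2 : ℂ) ^ 2 * -1 = -4 by norm_num]
  have hXY : X * Y = 4 ^ k * C := by
    rw [hX, hY, ← Finset.prod_mul_distrib]
    have : ∀ m ∈ Finset.range (2 * k), (rightRoot k m + Complex.I) * (rightRoot k m - Complex.I) =
        2 * ((Real.cos (rightAngle k m) : ℂ) * rightRoot k m) := fun m _ => by
      linear_combination rightRoot k m * rightRoot_add_conj k m - rightRoot_mul_conj k m -
        Complex.I_sq
    rw [Finset.prod_congr rfl this, Finset.prod_mul_distrib, Finset.prod_mul_distrib,
      Finset.prod_const, Finset.card_range, prod_rightRoot, pow_mul, mul_one,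
      show (2 : ℂ) ^ 2 = 4 by norm_num]
  apply mul_left_cancel₀ hne
  rw [hXY, mul_left_comm, hXX, ← mul_assoc, ← mul_pow]
  norm_num

/-- The reflected angles add up to `(2k + 1) h = π / 2`, so the square of the product is `1`; all
factors are positive. -/
theorem prod_tan_eq_one (k n : ℕ) (hn : n + 2 = 2 * k) :
    ∏ j ∈ Finset.range n, Real.tan ((j + 2) * (Real.pi / (2 * (2 * k + 1)))) = 1 := by
  have h1 := step_pos k
  have h2 := step_mul k
  set h := Real.pi / (2 * (2 * (k : ℝ) + 1))
  have hn' : (n : ℝ) + 2 = 2 * k := by exact_mod_cast hn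
  have hlt : ∀ j ∈ Finset.range n, (j : ℝ) + 1 ≤ n := fun j hj => by
    exact_mod_cast Finset.mem_range.1 hj
  have hpos : ∀ j ∈ Finset.range n, 0 < Real.tan ((j + 2) * h) := fun j hj => by
    have := hlt j hj
    have h0 : (0 : ℝ) ≤ j := Nat.cast_nonneg j
    exact Real.tan_pos_of_pos_of_lt_pi_div_two (by positivity) (by nlinarith)
  set Q := ∏ j ∈ Finset.range n, Real.tan ((j + 2) * h) with hQ
  have hQpos : 0 < Q := Finset.prod_pos hpos
  have hQQ : Q * Q = 1 := by
    conv_lhs => enter [2]; rw [hQ, ← Finset.prod_range_reflect]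
    rw [hQ, ← Finset.prod_mul_distrib]
    refine Finset.prod_eq_one fun j hj => ?_
    have hj' := Finset.mem_range.1 hj
    have : (((n - 1 - j : ℕ) : ℝ) + 2) * h = Real.pi / 2 - (j + 2) * h := by
      rw [Nat.cast_sub (by omega), Nat.cast_sub (by omega)]
      push_cast
      linear_combination h2 + h * hn'
    rw [this, Real.tan_pi_div_two_sub, mul_inv_cancel₀ (hpos j hj).ne']
  nlinarith

theorem exp_sub_exp_eq_tan_mul {x y : ℝ} (h : Real.cos ((x - y) / 2) ≠ 0) :
    Complex.exp (x * Complex.I) - Complex.exp (y * Complex.I) =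
      Complex.I * Real.tan ((x - y) / 2) *
        (Complex.exp (x * Complex.I) + Complex.exp (y * Complex.I)) := by
  set u := (x - y) / 2 with hu
  have hx : Complex.exp (x * Complex.I) =
      Complex.exp (((x + y) / 2 : ℝ) * Complex.I) * Complex.exp (u * Complex.I) := by
    rw [← Complex.exp_add, hu]; push_cast; ring_nf
  have hy : Complex.exp (y * Complex.I) =
      Complex.exp (((x + y) / 2 : ℝ) * Complex.I) * Complex.exp ((-u : ℝ) * Complex.I) := by
    rw [← Complex.exp_add, hu]; push_cast; ring_nf
  have h' : (Real.cos u : ℂ) ≠ 0 := by exact_mod_cast h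
  rw [hx, hy, Complex.exp_mul_I (u : ℂ), Complex.exp_mul_I ((-u : ℝ) : ℂ), Real.tan_eq_sin_div_cos]
  push_cast at h' ⊢
  rw [Complex.cos_neg, Complex.sin_neg]
  field_simp
  ring

theorem rightRoots_erase_last {k n : ℕ} (hn : n + 1 = 2 * k) :
    (rightRoots k).erase (rightRoot k n) = (Finset.range n).image (rightRoot k) := by
  have hnot : rightRoot k n ∉ (Finset.range n).image (rightRoot k) := by
    intro h
    obtain ⟨m, hm, he⟩ := Finset.mem_image.1 h
    have hm' := Finset.mem_range.1 hm
    have := rightRoot_injOn k (by simp; omega) (by simp; omega) he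
    omega
  rw [rightRoots, ← hn, Finset.range_add_one, Finset.image_insert, Finset.erase_insert hnot]

/-- Each ratio `(a - p) / (a + p)` is `-i tan (j h)`, with `j` running through `1, …, 2k - 1`. The
factors with `j ≥ 2` multiply to `1`, which leaves `tan h` and `(-i) ^ (2k - 1) = (-1) ^ k i`. -/
theorem prod_erase_last_sub {k n : ℕ} (hn : n + 1 = 2 * k) :
    ∏ a ∈ (rightRoots k).erase (rightRoot k n), (a - rightRoot k n) =
      (-1) ^ k * Complex.I * (Real.tan (Real.pi / (2 * (2 * (k : ℝ) + 1))) : ℝ) *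
        ∏ a ∈ (rightRoots k).erase (rightRoot k n), (a + rightRoot k n) := by
  have h1 := step_pos k
  have h2 := step_mul k
  obtain ⟨l, rfl⟩ : ∃ l, n = l + 1 := ⟨n - 1, by omega⟩
  have hinj : Set.InjOn (rightRoot k) (Finset.range (l + 1)) :=
    (rightRoot_injOn k).mono (by
      rw [Finset.coe_subset]; exact Finset.range_subset_range.2 (by omega))
  rw [rightRoots_erase_last hn, Finset.prod_image hinj, Finset.prod_image hinj]
  have hangle : ∀ m, (rightAngle k m - rightAngle k (l + 1)) / 2 =
      -((l + 1 - m) * (Real.pi / (2 * (2 * k + 1)))) := fun m => by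
    rw [rightAngle, rightAngle]; push_cast; ring
  have hterm : ∀ m ∈ Finset.range (l + 1), rightRoot k m - rightRoot k (l + 1) =
      (-Complex.I) * (Real.tan ((l + 1 - m) * (Real.pi / (2 * (2 * k + 1)))) : ℝ) *
        (rightRoot k m + rightRoot k (l + 1)) := fun m hm => by
    have hm' : (m : ℝ) ≤ l := by exact_mod_cast Nat.lt_succ_iff.1 (Finset.mem_range.1 hm)
    have h0 : (0 : ℝ) ≤ m := Nat.cast_nonneg m
    have hl : (l : ℝ) + 2 = 2 * k := by exact_mod_cast hn
    have hcos : Real.cos ((rightAngle k m - rightAngle k (l + 1)) / 2) ≠ 0 := by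
      rw [hangle, Real.cos_neg]
      exact (Real.cos_pos_of_mem_Ioo ⟨by nlinarith, by nlinarith⟩).ne'
    have := exp_sub_exp_eq_tan_mul hcos
    rw [hangle, Real.tan_neg] at this
    rw [rightRoot, rightRoot, this]
    push_cast
    ring
  rw [Finset.prod_congr rfl hterm, Finset.prod_mul_distrib, Finset.prod_mul_distrib,
    Finset.prod_const, Finset.card_range, ← Complex.ofReal_prod, ← Finset.prod_range_reflect]
  have hrefl : ∀ j ∈ Finset.range (l + 1),
      Real.tan ((l + 1 - (l + 1 - 1 - j : ℕ)) * (Real.pi / (2 * (2 * k + 1)))) =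
        Real.tan ((j + 1) * (Real.pi / (2 * (2 * k + 1)))) := fun j hj => by
    have := Finset.mem_range.1 hj
    rw [Nat.cast_sub (by omega)]
    push_cast
    ring_nf
  rw [Finset.prod_congr rfl hrefl, Finset.prod_range_succ']
  have hone := prod_tan_eq_one k l (by omega)
  have hcast : ∀ j : ℕ, ((j + 1 : ℕ) : ℝ) + 1 = j + 2 := fun j => by push_cast; ring
  simp only [hcast]
  rw [hone]
  have hpow : (-Complex.I) ^ (l + 1) = (-1) ^ k * Complex.I := by
    have : (-Complex.I) ^ (l + 1) * (-Complex.I) = (-1) ^ k := by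
      rw [← pow_succ, hn, pow_mul, neg_sq, Complex.I_sq]
    linear_combination Complex.I * this + (-Complex.I) ^ (l + 1) * Complex.I_sq
  rw [hpow]
  simp

theorem conj_mem_rightRoots {k : ℕ} {b : ℂ} (hb : b ∈ rightRoots k) :
    starRingEnd ℂ b ∈ rightRoots k := by
  obtain ⟨m, hm, rfl⟩ := Finset.mem_image.1 hb
  have := Finset.mem_range.1 hm
  rw [← rightRoot_reflect this]
  exact rightRoot_mem (by omega)

theorem prod_erase_conj (k : ℕ) (p : ℂ) (f : ℂ → ℂ) :
    ∏ a ∈ (rightRoots k).erase (starRingEnd ℂ p), f a =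
      ∏ a ∈ (rightRoots k).erase p, f (starRingEnd ℂ a) := by
  refine Finset.prod_nbij' (starRingEnd ℂ) (starRingEnd ℂ) ?_ ?_ ?_ ?_ ?_
  · intro a ha
    rw [Finset.mem_erase] at ha ⊢
    refine ⟨fun h => ha.1 ?_, conj_mem_rightRoots ha.2⟩
    rw [← h, Complex.conj_conj]
  · intro a ha
    rw [Finset.mem_erase] at ha ⊢
    exact ⟨fun h => ha.1 ((starRingEnd ℂ).injective h), conj_mem_rightRoots ha.2⟩
  all_goals simp

theorem prod_erase_conj_last_sub {k n : ℕ} (hn : n + 1 = 2 * k) :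
    ∏ a ∈ (rightRoots k).erase (starRingEnd ℂ (rightRoot k n)),
        (a - starRingEnd ℂ (rightRoot k n)) =
      (-1) ^ k * Complex.I * (-(Real.tan (Real.pi / (2 * (2 * (k : ℝ) + 1))) : ℝ)) *
        ∏ a ∈ (rightRoots k).erase (starRingEnd ℂ (rightRoot k n)),
          (a + starRingEnd ℂ (rightRoot k n)) := by
  have h := congrArg (starRingEnd ℂ) (prod_erase_last_sub hn)
  simp only [map_mul, map_prod, map_sub, map_add, map_pow, map_neg, map_one, Complex.conj_I,
    Complex.conj_ofReal] at h
  rw [prod_erase_conj, prod_erase_conj, h]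
  ring

/-! ### Exponents and their comparison -/

theorem sum_rightRoots (k : ℕ) :
    ∑ b ∈ rightRoots k, b =
      ((2 * ∑ x ∈ Finset.range k, cosCoeff (2 * k + 1) (2 * x + 1) : ℝ) : ℂ) := by
  rw [rightRoots, Finset.sum_image (rightRoot_injOn k)]
  have hrefl : ∑ m ∈ Finset.range (2 * k), rightRoot k m =
      ∑ m ∈ Finset.range (2 * k), starRingEnd ℂ (rightRoot k m) := by
    rw [← Finset.sum_range_reflect]
    exact Finset.sum_congr rfl fun m hm => rightRoot_reflect (Finset.mem_range.1 hm)
  have hcos : ∑ m ∈ Finset.range (2 * k), rightRoot k m =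
      ((∑ m ∈ Finset.range (2 * k), Real.cos (rightAngle k m) : ℝ) : ℂ) := by
    have h2 : (2 : ℂ) * ∑ m ∈ Finset.range (2 * k), rightRoot k m =
        2 * ((∑ m ∈ Finset.range (2 * k), Real.cos (rightAngle k m) : ℝ) : ℂ) := by
      rw [Complex.ofReal_sum, Finset.mul_sum (Finset.range (2 * k))
        (fun m => ((Real.cos (rightAngle k m) : ℝ) : ℂ)),
        ← Finset.sum_congr rfl fun m _ => rightRoot_add_conj k m, Finset.sum_add_distrib, ← hrefl]
      ring
    exact mul_left_cancel₀ two_ne_zero h2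
  rw [hcos]
  congr 1
  -- The angles with `m ≥ k` are the positive ones, `(2x + 1) h`; the first half, reversed, consists
  -- of their negatives.
  rw [two_mul k, Finset.sum_range_add, ← Finset.sum_range_reflect, two_mul]
  congr 1
  · refine Finset.sum_congr rfl fun x hx => ?_
    have := Finset.mem_range.1 hx
    rw [cosCoeff, ← Real.cos_neg, rightAngle, Nat.cast_sub (by omega), Nat.cast_sub (by omega)]
    congr 1
    push_cast
    ring
  · refine Finset.sum_congr rfl fun x _ => ?_
    rw [cosCoeff, rightAngle]
    congr 1
    push_cast
    ring

theorem gammaOne_eq_sum {k : ℕ} (hk : 2 ≤ k) :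
    gammaOne (2 * k + 1) k = 2 * ∑ x ∈ Finset.range k, cosCoeff (2 * k + 1) (2 * x + 1) := by
  obtain ⟨n, rfl⟩ : ∃ n, k = n + 2 := ⟨k - 2, by omega⟩
  have hIcc : ∀ l α : ℕ, ∑ j ∈ Finset.Icc 1 l, cosCoeff α (2 * j - 1) =
      ∑ x ∈ Finset.range l, cosCoeff α (2 * x + 1) := fun l α => by
    induction l with
    | zero => simp
    | succ l ih =>
      rw [Finset.sum_Icc_succ_top (by omega), ih, Finset.sum_range_succ,
        show 2 * (l + 1) - 1 = 2 * l + 1 by omega]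
  rw [gammaOne, sigmaSum, Finset.sum_range_succ, Finset.sum_range_succ,
    show n + 2 - 2 = n by omega, show 2 * (n + 2) - 3 = 2 * n + 1 by omega,
    show 2 * (n + 2) - 1 = 2 * (n + 1) + 1 by omega, hIcc]
  ring

theorem cosCoeff_eq (k l : ℕ) :
    cosCoeff (2 * k + 1) l = Real.cos (l * (Real.pi / (2 * (2 * k + 1)))) := by
  rw [cosCoeff]
  congr 1
  push_cast
  ring

theorem sinCoeff_eq (k l : ℕ) :
    sinCoeff (2 * k + 1) l = Real.sin (l * (Real.pi / (2 * (2 * k + 1)))) := by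
  rw [sinCoeff]
  congr 1
  push_cast
  ring

theorem rightAngle_last {k : ℕ} (hk : 2 ≤ k) :
    rightAngle k (2 * k - 1) = (2 * k - 1 : ℕ) * (Real.pi / (2 * (2 * k + 1))) := by
  rw [rightAngle, Nat.cast_sub (by omega)]
  push_cast
  ring

/-- The hypotheses `h1`, `h2` say `|2m + 1 - 2k| ≤ l`; cosine is even and decreasing on `[0, π]`. -/
theorem cosCoeff_le_cos_rightAngle {k m l : ℕ} (hl : l ≤ 2 * k - 1) (h1 : 2 * m + 1 ≤ 2 * k + l)
    (h2 : 2 * k ≤ 2 * m + 1 + l) : cosCoeff (2 * k + 1) l ≤ Real.cos (rightAngle k m) := by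
  have hs := step_pos k
  have hm := step_mul k
  have e1 : (2 * m + 1 : ℝ) ≤ 2 * k + l := by exact_mod_cast h1
  have e2 : (2 * k : ℝ) ≤ 2 * m + 1 + l := by exact_mod_cast h2
  have e3 : (l : ℝ) ≤ 2 * k := by exact_mod_cast (by omega : l ≤ 2 * k)
  rw [cosCoeff_eq, ← Real.cos_abs (rightAngle k m)]
  refine Real.cos_le_cos_of_nonneg_of_le_pi (abs_nonneg _) (by nlinarith [Real.pi_pos]) ?_
  rw [rightAngle, abs_mul, abs_of_pos hs]
  exact mul_le_mul_of_nonneg_right (abs_le.2 ⟨by linarith, by linarith⟩) hs.le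

theorem cosCoeff_last_eq {k : ℕ} (hk : 2 ≤ k) :
    cosCoeff (2 * k + 1) (2 * k - 1) = Real.sin (2 * (Real.pi / (2 * (2 * k + 1)))) := by
  rw [cosCoeff_eq, ← Real.cos_pi_div_two_sub, ← step_mul k, Nat.cast_sub (by omega)]
  congr 1
  push_cast
  ring

/-- With `h = π / (2 (2k + 1))`, the two coefficients are `sin 4h` and `sin 2h`, and `sin 4h = 2 sin
2h cos 2h`. This makes any two losses at least as costly as the error term allows. -/
theorem cosCoeff_le_two_mul_last {k : ℕ} (hk : 2 ≤ k) :
    cosCoeff (2 * k + 1) (2 * k - 3) ≤ 2 * cosCoeff (2 * k + 1) (2 * k - 1) := by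
  have hpos : 0 ≤ cosCoeff (2 * k + 1) (2 * k - 1) := by
    rw [cosCoeff_eq, ← rightAngle_last hk]
    exact (cos_rightAngle_pos (by omega)).le
  have h : cosCoeff (2 * k + 1) (2 * k - 3) =
      2 * cosCoeff (2 * k + 1) (2 * k - 1) * Real.cos (2 * (Real.pi / (2 * (2 * k + 1)))) := by
    rw [cosCoeff_last_eq hk, ← Real.sin_two_mul, cosCoeff_eq, ← Real.cos_pi_div_two_sub,
      ← step_mul k, Nat.cast_sub (by omega)]
    congr 1
    push_cast
    ring
  rw [h]
  exact mul_le_of_le_one_right (by positivity) (Real.cos_le_one _)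

/-! ### Assembly for the boundary matrix -/

theorem theorem2p3 (α k : ℕ) (hα : α = 2 * k + 1) (h5 : 5 ≤ α) :
    ∃ K₁ K₂ : ℂ, K₁ ≠ 0 ∧ K₂ ≠ 0 ∧
      -K₂ / K₁ = ((2 / Real.sin (Real.pi / (2 * (α : ℝ))) ^ 2 : ℝ) : ℂ) ∧
      (fun μ : ℝ => (boundaryMatrix α μ).det -
          (K₁ * (Real.exp (gammaOne α k * μ) : ℂ) * (Real.sin μ : ℂ) +
            K₂ * (Real.exp (gammaTwo α k * μ) : ℂ) *
              (Real.sin (sinCoeff α (2 * k - 1) * μ) : ℂ)))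
        =O[atTop] (fun μ : ℝ => Real.exp (gammaThree α k * μ)) := by
  subst hα
  have hk : 2 ≤ k := by omega
  have hP := rightRoots_re_pos k
  have hlast : 2 * k - 1 + 1 = 2 * k := by omega
  set h := Real.pi / (2 * (2 * (k : ℝ) + 1)) with hh
  have hh0 : 0 < h := step_pos k
  have hhπ : (2 * (k : ℝ) + 1) * h = Real.pi / 2 := step_mul k
  have hk' : (2 : ℝ) ≤ k := by exact_mod_cast hk
  set c := cosCoeff (2 * k + 1) (2 * k - 1) with hc
  set y := sinCoeff (2 * k + 1) (2 * k - 1) with hy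
  set c' := cosCoeff (2 * k + 1) (2 * k - 3) with hc'
  set p := rightRoot k (2 * k - 1) with hp
  set q := starRingEnd ℂ p with hq
  have hpm : p ∈ rightRoots k := rightRoot_mem (by omega)
  have hqm : q ∈ rightRoots k := conj_mem_rightRoots hpm
  have hcos : Real.cos (rightAngle k (2 * k - 1)) = c := by
    rw [rightAngle_last hk, hc, cosCoeff_eq]
  have hsin : Real.sin (rightAngle k (2 * k - 1)) = y := by
    rw [rightAngle_last hk, hy, sinCoeff_eq]
  have hpy : p = c + y * Complex.I := by rw [hp, rightRoot_eq, hcos, hsin]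
  have hqy : q = c - y * Complex.I := by
    rw [hq, hpy]
    simp [sub_eq_add_neg]
  have hq0 : q = rightRoot k 0 := by
    have := rightRoot_reflect (k := k) (m := 2 * k - 1) (by omega)
    rw [← hp, ← hq] at this
    rw [← this]
    congr 1
    omega
  have hpq : p ≠ q := fun e => by
    rw [hq0] at e
    have := rightRoot_injOn k (by simp; omega) (by simp; omega) e
    omega
  have hpqmul : p * q = 1 := rightRoot_mul_conj k _
  have hpqadd : p + q = 2 * c := by rw [hpy, hqy]; ring
  have hcpos : 0 < c := hcos ▸ cos_rightAngle_pos (by omega)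
  have hcle : ∀ b ∈ rightRoots k, c ≤ b.re := fun b hb => by
    obtain ⟨m, hm, rfl⟩ := Finset.mem_image.1 hb
    have := Finset.mem_range.1 hm
    rw [rightRoot_re]
    exact cosCoeff_le_cos_rightAngle le_rfl (by omega) (by omega)
  have hc'le : ∀ b ∈ rightRoots k, b ≠ p → b ≠ q → c' ≤ b.re := fun b hb hbp hbq => by
    obtain ⟨m, hm, rfl⟩ := Finset.mem_image.1 hb
    have := Finset.mem_range.1 hm
    have h1 : m ≠ 2 * k - 1 := fun e => hbp (by rw [e])
    have h2 : m ≠ 0 := fun e => hbq (by rw [e, hq0])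
    rw [rightRoot_re]
    exact cosCoeff_le_cos_rightAngle (by omega) (by omega) (by omega)
  have hsinpos : 0 < Real.sin h :=
    Real.sin_pos_of_pos_of_lt_pi hh0 (by nlinarith [Real.pi_pos])
  have hcoshpos : 0 < Real.cos h :=
    Real.cos_pos_of_mem_Ioo ⟨by nlinarith [Real.pi_pos], by nlinarith [Real.pi_pos]⟩
  -- Here `c = sin 2h`; this identity is the source of `2 / sin² h`.
  have htc : Real.tan h * c = 2 * Real.sin h ^ 2 := by
    rw [hc, cosCoeff_last_eq hk, ← hh, Real.sin_two_mul, Real.tan_eq_sin_div_cos]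
    field_simp
  have htc0 : (Real.tan h : ℂ) * c ≠ 0 := by
    rw [← Complex.ofReal_mul, htc]
    exact_mod_cast (by positivity : 2 * Real.sin h ^ 2 ≠ 0)
  set z := rootEmbedding (2 * k + 1)
  obtain ⟨hmap, hcard⟩ := map_rootEmbedding_and_card k
  set V := (Matrix.vandermonde z).det
  have hV : V ≠ 0 := Matrix.det_vandermonde_ne_zero_iff.2 z.injective
  set D := crossSum (rightRoots k) (rightRoots k) * (∏ b ∈ rightRoots k, (b + Complex.I)) ^ 2
    with hD
  have hD0 : D ≠ 0 := by
    have := crossDiff_ne_zero (symmSet (rightRoots k)) (insert Complex.I (rightRoots k))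
    rw [crossDiff_insert_I hP] at this
    exact left_ne_zero_of_mul this
  have hK0 : V / D ≠ 0 := div_ne_zero hV hD0
  have hg : ∑ b ∈ rightRoots k, b = (gammaOne (2 * k + 1) k : ℝ) := by
    rw [sum_rightRoots, gammaOne_eq_sum hk]
  have hγ₂ : gammaTwo (2 * k + 1) k = gammaOne (2 * k + 1) k - c := by
    rw [gammaTwo, gammaOne, hc]; ring
  have hγ₃ : gammaThree (2 * k + 1) k = gammaOne (2 * k + 1) k - c' := by
    rw [gammaThree, gammaOne, hc']; ring
  refine ⟨V / D, -4 * (V / D) / (Real.tan h * c), hK0,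
    div_ne_zero (mul_ne_zero (by norm_num) hK0) htc0, ?_, ?_⟩
  · have hang : Real.pi / (2 * ((2 * k + 1 : ℕ) : ℝ)) = h := by rw [hh]; push_cast; rfl
    have hs0 : (Real.sin h : ℂ) ≠ 0 := by exact_mod_cast hsinpos.ne'
    rw [hang, ← Complex.ofReal_mul, htc]
    rw [Complex.ofReal_div, Complex.ofReal_mul, Complex.ofReal_pow]
    generalize V / D = K at hK0
    push_cast at hs0 ⊢
    field_simp
    norm_num
  · have hmain := sum_exp_sub_sin_isBigO hP hpm hqm hpq hcpos.le hcle hc'le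
      (cosCoeff_le_two_mul_last hk) (s := (-1) ^ k) (by rw [← pow_mul, mul_comm, pow_mul]; simp)
      (prod_rightRoots_sub_I k) (prod_erase_last_sub hlast) (prod_erase_conj_last_sub hlast)
      -- `p` and `q` are the roots of `x ^ 2 - 2 c x + 1`.
      (c := c) (by linear_combination p * hpqadd - hpqmul)
      (by linear_combination q * hpqadd - hpqmul) hpy hqy hg
      (K := V / D) (V := V) (div_mul_cancel₀ V hD0)
    rw [hγ₂, hγ₃]
    refine hmain.congr_left fun μ => ?_
    rw [boundaryMatrix_eq_stackedPowers, det_stackedPowers_exp, hmap, hcard]
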